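/- Let $A$ be a (not necessarily unital) $C^*$-algebra with centre $Z(A)$. An element $a\in A$ is called a CQ-element if for every closed two-sided ideal $I$ of $A$, $a+I\in Z(A/I)$ implies $a\in Z(A)+I$; let $\mathrm{CQ}(A)$ be the set of all CQ-elements of $A$. An element $a \in A$ is called quasi-nilpotent if its spectrum (computed in the unitization of $A$ if $A$ is not unital) contains no non-zero number, that is, if its spectral radius is $0$. (a) For all $a,b\in A$ the commutator $[a,b]=ab-ba$ belongs to $\mathrm{CQ}(A)$. Moreover, $\mathrm{CQ}(A)=Z(A)$ if and only if $A$ is abelian. (b) Every quasi-nilpotent element of $A$ belongs to $\mathrm{CQ}(A)$. Moreover, if $a\in A$ is quasi-nilpotent, then $ab\in\mathrm{CQ}(A)$ and $ba\in \mathrm{CQ}(A)$ for every $b\in A$. -/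

import Mathlib

/-- `a` is a CQ-element of the C*-algebra `A`: for every closed two-sided ideal `I` of `A`
(a two-sided ring ideal which is a complex subspace and norm-closed), if the class of `a` is
central in the quotient `A/I`, then `a ∈ Z(A) + I`. -/
def IsCQElement {A : Type*} [NonUnitalCStarAlgebra A] (a : A) : Prop :=
  ∀ I : TwoSidedIdeal A, (∀ (c : ℂ), ∀ x ∈ I, c • x ∈ I) → IsClosed (I : Set A) →
    (a : I.ringCon.Quotient) ∈ Set.center I.ringCon.Quotient →
    ∃ z ∈ Set.center A, ∃ y ∈ I, a = z + y

/-- The set `CQ(A)` of all CQ-elements of `A`. -/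
def CQ (A : Type*) [NonUnitalCStarAlgebra A] : Set A :=
  {a | IsCQElement a}

/-- `a` is quasi-nilpotent: its spectrum, computed in the unitization of `A`, is `{0}`.
(`quasispectrum ℂ a` is the spectrum of `a` in `Unitization ℂ A`; when `A` is already unital it is
the spectrum of `a` in `A` together with `0`.) -/
def IsQuasinilpotent {A : Type*} [NonUnitalCStarAlgebra A] (a : A) : Prop :=
  quasispectrum ℂ a = {0}

open Filter Topology

/-! ### Algebraic identities for central products and commutators. -/

section Commutators

variable {R : Type*} [Ring R]

/-! In each case an element central modulo `I` already lies in `I`, so the central summand can be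
`0`. A central class is normal, so it should vanish once it is quasi-nilpotent;
`mem_of_central_of_pow_small` proves this by functional calculus in the unitization, with no C*-norm
on the quotient. Smallness of powers modulo `I` has two sources. For `z = [a, b]`, the
Kleinecke–Shirokov identity `n! z ^ n = D^n (b ^ n)` with `D = [a, ·]` gives decay like `C ^ n /
n!`. For a product with a quasi-nilpotent factor, `(a * b) ^ n = a ^ n * b ^ n` and Gelfand's
formula applies. The abelian criterion is the commutator case with `I = 0`. -/

lemma mul_pow_eq_pow_mul_pow_of_central {a b : R} (h : ∀ x, a * b * x = x * (a * b)) (n : ℕ) :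
    (a * b) ^ n = a ^ n * b ^ n := by
  induction n with
  | zero => simp
  | succ n ih =>
    rw [pow_succ', ih, ← mul_assoc, h (a ^ n), pow_succ a, pow_succ' b]
    noncomm_ring

/-- If `[a, b]` is central, then applying `[a, ·]` to `b ^ n` exactly `n` times gives
`n! [a, b] ^ n`. -/
lemma iterate_commutator_pow {a b : R}
    (h : ∀ x, (a * b - b * a) * x = x * (a * b - b * a)) (n : ℕ) :
    (fun x => a * x - x * a)^[n] (b ^ n) = n.factorial • (a * b - b * a) ^ n := by
  set z := a * b - b * a with hz
  have hcomm : Function.Commute (fun x => a * x - x * a) (fun x => z * x) := by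
    intro x
    simp only [mul_sub, ← mul_assoc, h a]
  have hnsmul : ∀ m : ℕ, Function.Commute (fun x => a * x - x * a) (fun x : R => m • x) := by
    intro m x
    simp only [smul_sub, mul_smul_comm, smul_mul_assoc]
  have hpow : ∀ m : ℕ, a * b ^ (m + 1) - b ^ (m + 1) * a = (m + 1) • (z * b ^ m) := by
    intro m
    induction m with
    | zero => simp [hz]
    | succ m ih =>
      have : a * b ^ (m + 1 + 1) - b ^ (m + 1 + 1) * a
          = (a * b ^ (m + 1) - b ^ (m + 1) * a) * b + b ^ (m + 1) * z := by
        rw [hz, pow_succ b (m + 1)]; noncomm_ring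
      rw [this, ih, ← h, smul_mul_assoc, mul_assoc, ← pow_succ, succ_nsmul _ (m + 1)]
  induction n with
  | zero => simp
  | succ n ih =>
    rw [Function.iterate_succ_apply]
    simp only [hpow]
    rw [((hnsmul (n + 1)).iterate_left n).eq, (hcomm.iterate_left n).eq, ih, mul_smul_comm,
      ← pow_succ', smul_smul, Nat.factorial_succ]

end Commutators

/-! ### Ideal membership from small powers, in unital algebras. -/

section Unital

variable {B : Type*} [CStarAlgebra B]

lemma TwoSidedIdeal.smul_mem_of_algebra {𝕜 R : Type*} [CommRing 𝕜] [Ring R] [Algebra 𝕜 R]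
    (J : TwoSidedIdeal R) (c : 𝕜) {x : R} (hx : x ∈ J) : c • x ∈ J := by
  rw [Algebra.smul_def]
  exact J.mul_mem_left _ _ hx

lemma TwoSidedIdeal.mk_eq_mk_iff_sub_mem {R : Type*} [NonUnitalRing R] (J : TwoSidedIdeal R)
    {x y : R} : (x : J.ringCon.Quotient) = (y : J.ringCon.Quotient) ↔ x - y ∈ J := by
  rw [RingCon.eq, TwoSidedIdeal.rel_iff]

lemma TwoSidedIdeal.mem_of_forall_exists_norm_lt {R : Type*} [NonUnitalNormedRing R]
    (J : TwoSidedIdeal R) (hJ : IsClosed (J : Set R)) {x : R}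
    (h : ∀ δ > 0, ∃ y, x - y ∈ J ∧ ‖y‖ < δ) : x ∈ J := by
  have : x ∈ closure (J : Set R) := by
    rw [Metric.mem_closure_iff]
    intro δ hδ
    obtain ⟨y, hy, hy'⟩ := h δ hδ
    exact ⟨x - y, hy, by simpa [dist_eq_norm] using hy'⟩
  rwa [hJ.closure_eq] at this

/-- If the powers of `star z * z` are small modulo `J`, in the sense that their classes grow slower
than any geometric sequence, then `z` belongs to `J`. -/
lemma mem_of_star_mul_self_pow_small (J : TwoSidedIdeal B) (hJ : IsClosed (J : Set B)) (z : B)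
    (h : ∀ r > 0, ∀ δ > 0, ∃ n : ℕ, ∃ w, (star z * z) ^ n - w ∈ J ∧ ‖w‖ * r ^ n < δ) :
    z ∈ J := by
  set p := star z * z with hp
  have hsa : IsSelfAdjoint p := .star_mul_self z
  have hpos : ∀ t ∈ spectrum ℝ p, 0 ≤ t := fun t ht => spectrum_star_mul_self_nonneg t ht
  have hmax : ∀ {ε : ℝ}, 0 < ε → ∀ t : ℝ, 0 < max t ε := fun hε t => lt_max_of_lt_right hε
  have hcont : ∀ {ε : ℝ}, 0 < ε → Continuous fun t : ℝ => ε / max t ε := fun hε =>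
    continuous_const.div (by fun_prop) fun t => (hmax hε t).ne'
  -- The function `1 - ε / max t ε` vanishes for `t ≤ ε`, so it is `t ^ n` times a function bounded
  -- by `ε⁻¹ ^ n`; hence smallness of `p ^ n` modulo `J` passes to it.
  have hmem : ∀ ε : ℝ, 0 < ε → 1 - cfc (fun t : ℝ => ε / max t ε) p ∈ J := by
    intro ε hε
    refine J.mem_of_forall_exists_norm_lt hJ fun δ hδ => ?_
    obtain ⟨n, w, hw, hlt⟩ := h ε⁻¹ (inv_pos.2 hε) δ hδ
    set g : ℝ → ℝ := fun t => (1 - ε / max t ε) / max t ε ^ n with hg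
    have hgc : Continuous g := (continuous_const.sub (hcont hε)).div (by fun_prop)
      fun t => (pow_pos (hmax hε t) n).ne'
    have hfac : 1 - cfc (fun t : ℝ => ε / max t ε) p = p ^ n * cfc g p := by
      rw [← cfc_const_one ℝ p, ← cfc_sub _ _ p (by fun_prop) (hcont hε).continuousOn,
        ← cfc_pow_id (R := ℝ) p n, ← cfc_mul _ _ p (by fun_prop) hgc.continuousOn]
      refine cfc_congr fun t ht => ?_
      rcases le_total t ε with hle | hle
      · simp [hg, max_eq_right hle, hε.ne']
      · have : t ≠ 0 := (hε.trans_le hle).ne'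
        simp only [hg, max_eq_left hle]
        field_simp
    have hnorm : ‖cfc g p‖ ≤ ε⁻¹ ^ n := by
      refine norm_cfc_le (by positivity) fun t _ => ?_
      have h1 : ε / max t ε ≤ 1 := (div_le_one (hmax hε t)).2 (le_max_right _ _)
      have h0 : 0 ≤ ε / max t ε := (div_pos hε (hmax hε t)).le
      rw [Real.norm_of_nonneg (div_nonneg (by linarith) (pow_pos (hmax hε t) n).le), inv_pow,
        ← one_div]
      gcongr
      · linarith
      · exact le_max_right _ _
    refine ⟨w * cfc g p, ?_, ?_⟩
    · rw [hfac, ← sub_mul]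
      exact J.mul_mem_right _ _ hw
    · calc ‖w * cfc g p‖ ≤ ‖w‖ * ‖cfc g p‖ := norm_mul_le _ _
        _ ≤ ‖w‖ * ε⁻¹ ^ n := by gcongr
        _ < δ := hlt
  refine J.mem_of_forall_exists_norm_lt hJ fun δ hδ => ?_
  -- The cutoff `k` satisfies `‖z * k‖ ^ 2 ≤ ε`, while `z - z * k` lies in `J`.
  obtain ⟨ε, hε, hεδ⟩ : ∃ ε : ℝ, 0 < ε ∧ ε < δ ^ 2 := exists_between (by positivity)
  set k := cfc (fun t : ℝ => ε / max t ε) p with hk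
  refine ⟨z * k, ?_, ?_⟩
  · have : z - z * k = z * (1 - k) := by rw [mul_sub, mul_one]
    rw [this]
    exact J.mul_mem_left _ _ (hmem ε hε)
  · have hksa : star k = k := (cfc_predicate (R := ℝ) _ p : IsSelfAdjoint k)
    have hid : star (z * k) * (z * k)
        = cfc (fun t : ℝ => ε / max t ε * (t * (ε / max t ε))) p := by
      rw [cfc_mul _ _ p (hcont hε).continuousOn (by have := hcont hε; fun_prop),
        cfc_mul _ _ p (by fun_prop) (hcont hε).continuousOn, cfc_id' ℝ p, star_mul, hksa, hp]
      simp only [mul_assoc, hk, hp]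
    have hle : ‖z * k‖ ^ 2 ≤ ε := by
      rw [sq, ← CStarRing.norm_star_mul_self, hid]
      refine norm_cfc_le hε.le fun t ht => ?_
      have h0 := hpos t ht
      have hm := hmax hε t
      have h1 : ε / max t ε ≤ 1 := (div_le_one hm).2 (le_max_right _ _)
      have h2 : t * (ε / max t ε) ≤ ε := by
        rw [mul_div_assoc', div_le_iff₀ hm, mul_comm]
        gcongr
        exact le_max_left _ _
      rw [Real.norm_of_nonneg (by positivity)]
      calc _ ≤ 1 * ε := by gcongr
        _ = ε := one_mul ε
    exact lt_of_pow_lt_pow_left₀ 2 hδ.le (hle.trans_lt hεδ)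

lemma CStarAlgebra.norm_pow_le_pow_norm (x : B) (n : ℕ) : ‖x ^ n‖ ≤ ‖x‖ ^ n := by
  cases subsingleton_or_nontrivial B with
  | inl _ => rw [Subsingleton.elim (x ^ n) 0, norm_zero]; positivity
  | inr _ => exact norm_pow_le x n

/-- An element that is central and quasi-nilpotent modulo `J` belongs to `J`. -/
lemma mem_of_central_of_pow_small (J : TwoSidedIdeal B) (hJ : IsClosed (J : Set B)) {z : B}
    (hz : ∀ x, z * x - x * z ∈ J)
    (h : ∀ r > 0, ∀ δ > 0, ∃ n : ℕ, ∃ w, z ^ n - w ∈ J ∧ ‖w‖ * r ^ n < δ) : z ∈ J := by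
  refine mem_of_star_mul_self_pow_small J hJ z fun r hr δ hδ => ?_
  -- The factor `‖z‖ + 1` absorbs `star z ^ n`; adding `1` keeps the rate positive.
  obtain ⟨n, w, hw, hlt⟩ := h (r * (‖z‖ + 1)) (by positivity) δ hδ
  refine ⟨n, star z ^ n * w, ?_, ?_⟩
  · have key : (star z * z) ^ n - star z ^ n * z ^ n ∈ J := by
      have hz' : ∀ x, (z : J.ringCon.Quotient) * x = x * z := by
        intro x
        induction x using Quotient.inductionOn with | _ x => ?_
        exact (J.mk_eq_mk_iff_sub_mem).2 (hz x)
      rw [← J.mk_eq_mk_iff_sub_mem]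
      push_cast
      exact (show Commute _ _ from (hz' _).symm).mul_pow n
    have : (star z * z) ^ n - star z ^ n * w
        = ((star z * z) ^ n - star z ^ n * z ^ n) + star z ^ n * (z ^ n - w) := by
      rw [mul_sub]; abel
    rw [this]
    exact J.add_mem key (J.mul_mem_left _ _ hw)
  · refine lt_of_le_of_lt ?_ hlt
    have : ‖star z ^ n‖ ≤ (‖z‖ + 1) ^ n := by
      rw [← star_pow, norm_star]
      exact (CStarAlgebra.norm_pow_le_pow_norm z n).trans (by gcongr; linarith)
    calc ‖star z ^ n * w‖ * r ^ n ≤ (‖star z ^ n‖ * ‖w‖) * r ^ n := by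
          gcongr; exact norm_mul_le _ _
      _ ≤ ((‖z‖ + 1) ^ n * ‖w‖) * r ^ n := by gcongr
      _ = ‖w‖ * (r * (‖z‖ + 1)) ^ n := by rw [mul_pow]; ring

lemma norm_iterate_commutator_le (a x : B) (n : ℕ) :
    ‖(fun x => a * x - x * a)^[n] x‖ ≤ (2 * ‖a‖) ^ n * ‖x‖ := by
  induction n with
  | zero => simp
  | succ n ih =>
    rw [Function.iterate_succ_apply']
    set y := (fun x => a * x - x * a)^[n] x
    calc ‖a * y - y * a‖ ≤ ‖a * y‖ + ‖y * a‖ := norm_sub_le _ _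
      _ ≤ ‖a‖ * ‖y‖ + ‖y‖ * ‖a‖ := add_le_add (norm_mul_le _ _) (norm_mul_le _ _)
      _ = 2 * ‖a‖ * ‖y‖ := by ring
      _ ≤ 2 * ‖a‖ * ((2 * ‖a‖) ^ n * ‖x‖) := by gcongr
      _ = (2 * ‖a‖) ^ (n + 1) * ‖x‖ := by ring

/-- A commutator that is central modulo `J` belongs to `J`. -/
lemma commutator_mem_of_central (J : TwoSidedIdeal B) (hJ : IsClosed (J : Set B)) {a b : B}
    (hz : ∀ x, (a * b - b * a) * x - x * (a * b - b * a) ∈ J) : a * b - b * a ∈ J := by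
  refine mem_of_central_of_pow_small J hJ hz fun r hr δ hδ => ?_
  obtain ⟨n, hn⟩ := ((FloorSemiring.tendsto_pow_div_factorial_atTop
    (2 * ‖a‖ * ‖b‖ * r)).eventually (gt_mem_nhds hδ)).exists
  have hfac : (n.factorial : ℂ) ≠ 0 := by exact_mod_cast n.factorial_ne_zero
  set D : B → B := fun x => a * x - x * a with hD
  refine ⟨n, (n.factorial : ℂ)⁻¹ • D^[n] (b ^ n), ?_, ?_⟩
  · have key : n.factorial • (a * b - b * a) ^ n - D^[n] (b ^ n) ∈ J := by
      have hz' : ∀ x : J.ringCon.Quotient, ((a : J.ringCon.Quotient) * b - b * a) * x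
          = x * ((a : J.ringCon.Quotient) * b - b * a) := by
        intro x
        induction x using Quotient.inductionOn with | _ x => ?_
        exact (J.mk_eq_mk_iff_sub_mem).2 (hz x)
      have hsemi : Function.Semiconj (fun x : B => (x : J.ringCon.Quotient)) D
          (fun x => (a : J.ringCon.Quotient) * x - x * a) := fun x => rfl
      rw [← J.mk_eq_mk_iff_sub_mem]
      refine Eq.symm ((hsemi.iterate_right n (b ^ n)).trans ?_)
      exact iterate_commutator_pow hz' n
    have := J.smul_mem_of_algebra (n.factorial : ℂ)⁻¹ key
    rwa [smul_sub, ← Nat.cast_smul_eq_nsmul ℂ, inv_smul_smul₀ hfac] at this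
  · refine lt_of_le_of_lt ?_ hn
    rw [norm_smul, norm_inv, Complex.norm_natCast]
    calc (n.factorial : ℝ)⁻¹ * ‖D^[n] (b ^ n)‖ * r ^ n
        ≤ (n.factorial : ℝ)⁻¹ * ((2 * ‖a‖) ^ n * ‖b‖ ^ n) * r ^ n := by
          gcongr
          exact (norm_iterate_commutator_le a _ n).trans
            (by gcongr; exact CStarAlgebra.norm_pow_le_pow_norm b n)
      _ = (2 * ‖a‖ * ‖b‖ * r) ^ n / n.factorial := by
          rw [mul_pow (2 * ‖a‖ * ‖b‖), mul_pow (2 * ‖a‖)]; ring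

lemma exists_norm_pow_mul_pow_lt {a : B} (ha : spectralRadius ℂ a = 0) {r δ : ℝ} (hr : 0 < r)
    (hδ : 0 < δ) : ∃ n : ℕ, ‖a ^ n‖ * r ^ n < δ := by
  have hlim := spectrum.pow_norm_pow_one_div_tendsto_nhds_spectralRadius a
  rw [ha] at hlim
  -- Below `(2 * r)⁻¹`, the `n`-th roots of `‖a ^ n‖` leave a factor `(1 / 2) ^ n` after multiplying
  -- by `r ^ n`.
  have hev := hlim.eventually_lt_const (ENNReal.ofReal_pos.2 (show 0 < (2 * r)⁻¹ by positivity))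
  have hhalf := (tendsto_pow_atTop_nhds_zero_of_lt_one (r := (1 / 2 : ℝ)) (by norm_num)
    (by norm_num)).eventually (gt_mem_nhds hδ)
  obtain ⟨n, hn, hn', hn0⟩ := (hev.and (hhalf.and (eventually_gt_atTop 0))).exists
  refine ⟨n, lt_of_le_of_lt ?_ hn'⟩
  rw [ENNReal.ofReal_lt_ofReal_iff (by positivity)] at hn
  have h1 : ‖a ^ n‖ ≤ (2 * r)⁻¹ ^ n := by
    have := pow_le_pow_left₀ (by positivity) hn.le n
    rwa [one_div, Real.rpow_inv_natCast_pow (norm_nonneg _) hn0.ne'] at this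
  calc ‖a ^ n‖ * r ^ n ≤ (2 * r)⁻¹ ^ n * r ^ n := by gcongr
    _ = (1 / 2) ^ n := by rw [← mul_pow]; congr 1; field_simp

/-- A product with a quasi-nilpotent factor that is central modulo `J` belongs to `J`. -/
lemma mul_mem_of_spectralRadius_eq_zero (J : TwoSidedIdeal B) (hJ : IsClosed (J : Set B))
    {a b : B} (hab : spectralRadius ℂ a = 0 ∨ spectralRadius ℂ b = 0)
    (hz : ∀ x, a * b * x - x * (a * b) ∈ J) : a * b ∈ J := by
  refine mem_of_central_of_pow_small J hJ hz fun r hr δ hδ => ?_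
  have hmem : ∀ n : ℕ, (a * b) ^ n - a ^ n * b ^ n ∈ J := by
    have hz' : ∀ x : J.ringCon.Quotient, (a : J.ringCon.Quotient) * b * x
        = x * ((a : J.ringCon.Quotient) * b) := by
      intro x
      induction x using Quotient.inductionOn with | _ x => ?_
      exact (J.mk_eq_mk_iff_sub_mem).2 (hz x)
    intro n
    rw [← J.mk_eq_mk_iff_sub_mem]
    exact mul_pow_eq_pow_mul_pow_of_central hz' n
  suffices ∃ n : ℕ, ‖a ^ n‖ * ‖b ^ n‖ * r ^ n < δ by
    obtain ⟨n, hn⟩ := this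
    exact ⟨n, _, hmem n, lt_of_le_of_lt (by gcongr; exact norm_mul_le _ _) hn⟩
  have hle : ∀ (x : B) (n : ℕ), ‖x ^ n‖ ≤ (‖x‖ + 1) ^ n := fun x n =>
    (CStarAlgebra.norm_pow_le_pow_norm x n).trans (by gcongr; linarith)
  rcases hab with ha | hb
  · obtain ⟨n, hn⟩ := exists_norm_pow_mul_pow_lt ha (r := (‖b‖ + 1) * r) (by positivity) hδ
    refine ⟨n, lt_of_le_of_lt ?_ hn⟩
    rw [mul_pow, ← mul_assoc]
    gcongr
    exact hle b n
  · obtain ⟨n, hn⟩ := exists_norm_pow_mul_pow_lt hb (r := (‖a‖ + 1) * r) (by positivity) hδ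
    refine ⟨n, lt_of_le_of_lt ?_ hn⟩
    rw [mul_pow, ← mul_assoc, mul_comm ‖a ^ n‖]
    gcongr
    exact hle a n

end Unital

/-! ### Transfer to the unitization and conclusion. -/

section NonUnital

variable {A : Type*} [NonUnitalCStarAlgebra A]

/-- A two-sided ideal of `A` that is a complex subspace, viewed as an ideal of the unitization. -/
def TwoSidedIdeal.unitization (I : TwoSidedIdeal A) (hI : ∀ (c : ℂ), ∀ x ∈ I, c • x ∈ I) :
    TwoSidedIdeal (Unitization ℂ A) :=
  .mk' ((↑) '' (I : Set A)) ⟨0, I.zero_mem, by simp⟩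
    (by
      rintro _ _ ⟨x, hx, rfl⟩ ⟨y, hy, rfl⟩
      exact ⟨x + y, I.add_mem hx hy, by simp⟩)
    (by
      rintro _ ⟨x, hx, rfl⟩
      exact ⟨-x, I.neg_mem hx, by simp⟩)
    (by
      rintro u _ ⟨x, hx, rfl⟩
      refine ⟨u.fst • x + u.snd * x, I.add_mem (hI _ _ hx) (I.mul_mem_left _ _ hx), ?_⟩
      ext <;> simp)
    (by
      rintro _ u ⟨x, hx, rfl⟩
      refine ⟨u.fst • x + x * u.snd, I.add_mem (hI _ _ hx) (I.mul_mem_right _ _ hx), ?_⟩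
      ext <;> simp)

lemma TwoSidedIdeal.coe_unitization (I : TwoSidedIdeal A) (hI : ∀ (c : ℂ), ∀ x ∈ I, c • x ∈ I) :
    (I.unitization hI : Set (Unitization ℂ A)) = (↑) '' (I : Set A) :=
  TwoSidedIdeal.coe_mk' _ _ _ _ _ _

lemma TwoSidedIdeal.inr_mem_unitization (I : TwoSidedIdeal A)
    (hI : ∀ (c : ℂ), ∀ x ∈ I, c • x ∈ I) {x : A} :
    (x : Unitization ℂ A) ∈ I.unitization hI ↔ x ∈ I := by
  rw [← SetLike.mem_coe, coe_unitization, Unitization.inr_injective.mem_set_image, SetLike.mem_coe]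

lemma TwoSidedIdeal.isClosed_unitization (I : TwoSidedIdeal A)
    (hI : ∀ (c : ℂ), ∀ x ∈ I, c • x ∈ I) (hc : IsClosed (I : Set A)) :
    IsClosed (I.unitization hI : Set (Unitization ℂ A)) := by
  rw [coe_unitization]
  exact (Unitization.isometry_inr (𝕜 := ℂ) (A := A)).isClosedEmbedding.isClosedMap _ hc

/-- The scalar part of `u` commutes with `a`, so only `u.snd` contributes. -/
lemma TwoSidedIdeal.inr_commutator_mem_unitization (I : TwoSidedIdeal A)
    (hI : ∀ (c : ℂ), ∀ x ∈ I, c • x ∈ I) {a : A} (h : ∀ x, a * x - x * a ∈ I)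
    (u : Unitization ℂ A) : (a : Unitization ℂ A) * u - u * a ∈ I.unitization hI := by
  have : (a : Unitization ℂ A) * u - u * a = ((a * u.snd - u.snd * a : A) : Unitization ℂ A) := by
    ext
    · simp [sub_eq_add_neg]
    · simp only [sub_eq_add_neg, Unitization.snd_add, Unitization.snd_neg, Unitization.snd_mul,
        Unitization.fst_inr, Unitization.snd_inr, zero_smul]
      abel
  rw [this, inr_mem_unitization]
  exact h _

lemma commutator_mem_of_central_mod {I : TwoSidedIdeal A} (hI : ∀ (c : ℂ), ∀ x ∈ I, c • x ∈ I)
    (hc : IsClosed (I : Set A)) {a b : A}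
    (h : ∀ x, (a * b - b * a) * x - x * (a * b - b * a) ∈ I) : a * b - b * a ∈ I := by
  rw [← I.inr_mem_unitization hI, Unitization.inr_sub, Unitization.inr_mul, Unitization.inr_mul]
  refine commutator_mem_of_central _ (I.isClosed_unitization hI hc) fun u => ?_
  simpa using I.inr_commutator_mem_unitization hI h u

lemma IsQuasinilpotent.spectralRadius_inr {a : A} (ha : IsQuasinilpotent a) :
    spectralRadius ℂ (a : Unitization ℂ A) = 0 := by
  rw [IsQuasinilpotent, Unitization.quasispectrum_eq_spectrum_inr] at ha
  simp [spectralRadius, ha]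

lemma IsCQElement.of_forall_mem {a : A}
    (h : ∀ I : TwoSidedIdeal A, (∀ (c : ℂ), ∀ x ∈ I, c • x ∈ I) → IsClosed (I : Set A) →
      (∀ x, a * x - x * a ∈ I) → a ∈ I) : IsCQElement a := by
  intro I hI hc ha
  refine ⟨0, Set.zero_mem_center, a, h I hI hc fun x => ?_, (zero_add a).symm⟩
  rw [← I.mk_eq_mk_iff_sub_mem]
  exact (Set.mem_center_iff.1 ha).comm (x : I.ringCon.Quotient)

lemma isCQElement_commutator (a b : A) : IsCQElement (a * b - b * a) :=
  .of_forall_mem fun _ hI hc h => commutator_mem_of_central_mod hI hc h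

lemma IsCQElement.of_mem_center {a : A} (ha : a ∈ Set.center A) : IsCQElement a :=
  fun I _ _ _ => ⟨a, ha, 0, I.zero_mem, (add_zero a).symm⟩

lemma CQ_eq_center_iff : CQ A = Set.center A ↔ ∀ a b : A, a * b = b * a := by
  refine ⟨fun h a b => ?_, fun h => ?_⟩
  · have hz : a * b - b * a ∈ Set.center A := h ▸ isCQElement_commutator a b
    have hmem : a * b - b * a ∈ (⊥ : TwoSidedIdeal A) := by
      refine commutator_mem_of_central_mod (fun c x hx => ?_) ?_ fun x => ?_
      · rw [TwoSidedIdeal.mem_bot] at hx ⊢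
        rw [hx, smul_zero]
      · rw [TwoSidedIdeal.coe_bot]
        exact isClosed_singleton
      · rw [TwoSidedIdeal.mem_bot, sub_eq_zero]
        exact (Set.mem_center_iff.1 hz).comm x
    rwa [TwoSidedIdeal.mem_bot, sub_eq_zero] at hmem
  · refine Set.Subset.antisymm (fun a _ => ?_) fun a ha => IsCQElement.of_mem_center ha
    exact Semigroup.mem_center_iff.2 fun b => h b a

lemma IsQuasinilpotent.isCQElement {a : A} (ha : IsQuasinilpotent a) : IsCQElement a := by
  refine .of_forall_mem fun I hI hc h => ?_
  -- The product case with second factor `1`, available in the unitization.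
  rw [← I.inr_mem_unitization hI, ← mul_one (a : Unitization ℂ A)]
  refine mul_mem_of_spectralRadius_eq_zero _ (I.isClosed_unitization hI hc)
    (.inl ha.spectralRadius_inr) fun u => ?_
  simpa using I.inr_commutator_mem_unitization hI h u

lemma isCQElement_mul_of_isQuasinilpotent {a b : A}
    (hab : IsQuasinilpotent a ∨ IsQuasinilpotent b) : IsCQElement (a * b) := by
  refine .of_forall_mem fun I hI hc h => ?_
  rw [← I.inr_mem_unitization hI, Unitization.inr_mul]
  refine mul_mem_of_spectralRadius_eq_zero _ (I.isClosed_unitization hI hc)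
    (hab.imp (·.spectralRadius_inr) (·.spectralRadius_inr)) fun u => ?_
  simpa using I.inr_commutator_mem_unitization hI h u

end NonUnital

theorem mainTheorem8 (A : Type*) [NonUnitalCStarAlgebra A] :
    (∀ a b : A, a * b - b * a ∈ CQ A) ∧
    (CQ A = Set.center A ↔ ∀ a b : A, a * b = b * a) ∧
    (∀ a : A, IsQuasinilpotent a → a ∈ CQ A) ∧
    (∀ a : A, IsQuasinilpotent a → ∀ b : A, a * b ∈ CQ A ∧ b * a ∈ CQ A) :=
  ⟨isCQElement_commutator, CQ_eq_center_iff, fun _ ha => ha.isCQElement, fun _ ha _ =>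
    ⟨isCQElement_mul_of_isQuasinilpotent (.inl ha), isCQElement_mul_of_isQuasinilpotent (.inr ha)⟩⟩
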